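/- Let $(X,\mu)$ be a standard Borel space with a $\sigma$-finite measure, and let $L^2(X)=L^2(X,\mu)$ be the complex $L^2$-space. Let $\mathcal B(L^2(X))$ be the bounded operators and $\mathcal K$ the compact operators on $L^2(X)$. For $a\in L^\infty(X)$ let $M_a\xi=a\xi$ ($\xi\in L^2(X)$), and let $\mathcal D=\{M_a : a\in L^\infty(X)\}$. A linear subspace $\mathcal U\subseteq\mathcal B(L^2(X))$ is called a masa-bimodule if $ATB\in\mathcal U$ whenever $T\in\mathcal U$ and $A,B\in\mathcal D$. The weak* topology on $\mathcal B(L^2(X))$ is the coarsest topology making all functionals $T\mapsto\sum_{i=1}^\infty (Tf_i,g_i)$ continuous, where $(f_i)$, $(g_i)$ are sequences in $L^2(X)$ with $\sum_i\|f_i\|^2<\infty$ and $\sum_i\|g_i\|^2<\infty$. A weak* closed masa-bimodule $\mathcal W$ is called a bimodule of uniqueness if $\mathcal W\cap\mathcal K=\{0\}$. Theorem. Let $\mathcal U,\mathcal V\subseteq\mathcal B(L^2(X))$ be weak* closed masa-bimodules. If $\mathcal U\cap\mathcal V$ is a bimodule of uniqueness, then $$\overline{\mathcal U+\mathcal V}^{\,w^*}\cap\mathcal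 K=\overline{(\mathcal U\cap\mathcal K)+(\mathcal V\cap\mathcal K)}^{\,\|\cdot\|},$$ where the closure on the right is taken in the operator norm. -/

import Mathlib

open MeasureTheory
open scoped ENNReal Topology

/-- The pairing `⟨T, h⟩ = ∑ i, (T fᵢ, gᵢ)` of a bounded operator `T` with the element
`h = ∑ i, fᵢ ⊗ conj gᵢ` of the projective tensor product (the predual of `B(H)`), given by two
square summable sequences `f, g` of vectors of `H`. Mathlib's inner product is linear in its
second argument, so `(u, v)` is `inner ℂ v u`. -/
noncomputable def predualPairing {H : Type*} [NormedAddCommGroup H] [InnerProductSpace ℂ H]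
    (f g : lp (fun _ : ℕ => H) 2) (T : H →L[ℂ] H) : ℂ :=
  ∑' i, inner ℂ (g i) (T (f i))

/-- The series defining the pairing always converges absolutely. -/
theorem summable_predualPairing {H : Type*} [NormedAddCommGroup H] [InnerProductSpace ℂ H]
    (f g : lp (fun _ : ℕ => H) 2) (T : H →L[ℂ] H) :
    Summable fun i => ‖inner ℂ (g i) (T (f i))‖ := by
  have hf : Summable fun i => ‖f i‖ ^ 2 := by
    simpa using (lp.memℓp f).summable (by norm_num)
  have hg : Summable fun i => ‖g i‖ ^ 2 := by
    simpa using (lp.memℓp g).summable (by norm_num)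
  refine Summable.of_nonneg_of_le (fun _ => norm_nonneg _) (fun i => ?_)
    ((hg.add hf).mul_left ‖T‖)
  have h1 : ‖inner ℂ (g i) (T (f i))‖ ≤ ‖g i‖ * (‖T‖ * ‖f i‖) :=
    (norm_inner_le_norm _ _).trans (by gcongr; exact T.le_opNorm _)
  have h2 : ‖g i‖ * ‖f i‖ ≤ ‖g i‖ ^ 2 + ‖f i‖ ^ 2 := by
    nlinarith [sq_nonneg (‖g i‖ - ‖f i‖), sq_nonneg ‖g i‖, sq_nonneg ‖f i‖]
  calc ‖inner ℂ (g i) (T (f i))‖ ≤ ‖g i‖ * (‖T‖ * ‖f i‖) := h1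
    _ = ‖T‖ * (‖g i‖ * ‖f i‖) := by ring
    _ ≤ ‖T‖ * (‖g i‖ ^ 2 + ‖f i‖ ^ 2) := by gcongr

/-- The weak* topology of `B(H)`: the coarsest topology for which the pairing with every element
of the predual is continuous. -/
@[reducible]
noncomputable def weakStarTopology (H : Type*) [NormedAddCommGroup H] [InnerProductSpace ℂ H] :
    TopologicalSpace (H →L[ℂ] H) :=
  ⨅ h : lp (fun _ : ℕ => H) 2 × lp (fun _ : ℕ => H) 2,
    TopologicalSpace.induced (predualPairing h.1 h.2) inferInstance

/-- The space `K` of compact operators on `H`, as a subspace of `B(H)`. -/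
abbrev compacts (H : Type*) [NormedAddCommGroup H] [InnerProductSpace ℂ H] :
    Submodule ℂ (H →L[ℂ] H) :=
  compactOperator (RingHom.id ℂ) H H

section
variable {X : Type*} [MeasurableSpace X]

/-- The multiplication operator `M_a ξ = a ξ` on `L²(X)`, for `a ∈ L^∞(X)`. -/
noncomputable def mulOp (μ : Measure X) (a : Lp ℂ ∞ μ) : Lp ℂ 2 μ →L[ℂ] Lp ℂ 2 μ :=
  (ContinuousLinearMap.mul ℂ ℂ).holderL μ ∞ 2 2 a

theorem coeFn_mulOp (μ : Measure X) (a : Lp ℂ ∞ μ) (ξ : Lp ℂ 2 μ) :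
    mulOp μ a ξ =ᵐ[μ] fun x => a x * ξ x :=
  (ContinuousLinearMap.mul ℂ ℂ).coeFn_holder a ξ

/-- The multiplication masa `D = {M_a : a ∈ L^∞(X)}`. -/
def multiplicationMasa (μ : Measure X) : Set (Lp ℂ 2 μ →L[ℂ] Lp ℂ 2 μ) :=
  Set.range (mulOp μ)

/-- A subspace `U` of `B(L²(X))` is a masa-bimodule if `A T B ∈ U` for `T ∈ U` and `A, B ∈ D`. -/
def IsMasaBimodule (μ : Measure X) (U : Submodule ℂ (Lp ℂ 2 μ →L[ℂ] Lp ℂ 2 μ)) : Prop :=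
  ∀ T ∈ U, ∀ A ∈ multiplicationMasa μ, ∀ B ∈ multiplicationMasa μ, A ∘L T ∘L B ∈ U

/-- `U` is a weak* closed masa-bimodule in `B(L²(X))`. -/
structure IsWeakStarClosedMasaBimodule (μ : Measure X)
    (U : Submodule ℂ (Lp ℂ 2 μ →L[ℂ] Lp ℂ 2 μ)) : Prop where
  isMasaBimodule : IsMasaBimodule μ U
  isClosed : IsClosed[weakStarTopology (Lp ℂ 2 μ)] (U : Set (Lp ℂ 2 μ →L[ℂ] Lp ℂ 2 μ))

/-- The intersection of two weak* closed masa-bimodules is again one. -/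
theorem IsWeakStarClosedMasaBimodule.inf {μ : Measure X}
    {U V : Submodule ℂ (Lp ℂ 2 μ →L[ℂ] Lp ℂ 2 μ)}
    (hU : IsWeakStarClosedMasaBimodule μ U) (hV : IsWeakStarClosedMasaBimodule μ V) :
    IsWeakStarClosedMasaBimodule μ (U ⊓ V) where
  isMasaBimodule T hT A hA B hB :=
    ⟨hU.isMasaBimodule T hT.1 A hA B hB, hV.isMasaBimodule T hT.2 A hA B hB⟩
  isClosed := @IsClosed.inter _ _ _ (weakStarTopology (Lp ℂ 2 μ)) hU.isClosed hV.isClosed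

/-- A bimodule of multiplicity: a weak* closed masa-bimodule `U` with `U ∩ K ≠ {0}`. -/
def IsBimoduleOfMultiplicity (μ : Measure X)
    (U : Submodule ℂ (Lp ℂ 2 μ →L[ℂ] Lp ℂ 2 μ)) : Prop :=
  IsWeakStarClosedMasaBimodule μ U ∧ U ⊓ compacts (Lp ℂ 2 μ) ≠ ⊥

/-- A bimodule of uniqueness: a weak* closed masa-bimodule which is not a bimodule of
multiplicity. -/
def IsBimoduleOfUniqueness (μ : Measure X)
    (U : Submodule ℂ (Lp ℂ 2 μ →L[ℂ] Lp ℂ 2 μ)) : Prop :=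
  IsWeakStarClosedMasaBimodule μ U ∧ ¬ IsBimoduleOfMultiplicity μ U

end

/-! Regard a predual element as the kernel h(x,y) = ∑ fᵢ(x) conj(gᵢ(y)). If h has bounded
representatives with ∑ |fᵢ|² and ∑ |gᵢ|² essentially bounded, it acts on compact operators by S_h(T)
= ∑ M_{gᵢ}* T M_{fᵢ} (`columnSum`). This action keeps compactness and is dual to multiplication of
kernels: ⟨S_h T, h'⟩ = ⟨T, h h'⟩ = ⟨S_{h'} T, h⟩.

Let K be a compact operator in the weak* closure of U + V. If h' annihilates U and h'' annihilates
V, the bimodule property makes h'h'' annihilate both, hence K; so S_{h'} K lies in V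
(`columnSum_mem`). If h annihilates only V ∩ 𝒦, then for every such h' one has ⟨S_h K, h'⟩ = ⟨S_{h'}
K, h⟩ = 0, because S_{h'} K is compact and in V. Thus S_h K lies in U (`columnSum_mem_of_compacts`).
When h annihilates both compact parts, symmetry puts S_h K in U ∩ V ∩ 𝒦 = 0, and this forces ⟨K, h⟩
= 0.

Hahn–Banach reduces the hard inclusion to this statement: bounded functionals restrict to the
compacts as predual elements (`exists_pairing_eq_on_compacts`), and cutoffs by indicators make their
kernels bounded (`exists_isCutoff`). -/

/-! ### Predual functionals, weak* separation and finite-rank approximation -/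

section Pairing

open InnerProductSpace

variable {ι : Type*} {H : Type*} [NormedAddCommGroup H]

/-- A family of vectors with square summable norms. -/
def SqSummable (f : ι → H) : Prop := Summable fun i => ‖f i‖ ^ 2

theorem lp.sqSummable (f : lp (fun _ : ℕ => H) 2) : SqSummable f := by
  simpa [SqSummable] using (lp.memℓp f).summable (by norm_num)

theorem SqSummable.memℓp {f : ι → H} (hf : SqSummable f) : Memℓp f 2 := by
  refine memℓp_gen ?_
  simpa [SqSummable] using hf

theorem SqSummable.mul {f g : ι → H} (hf : SqSummable f) (hg : SqSummable g) :
    Summable fun i => ‖f i‖ * ‖g i‖ := by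
  refine Summable.of_nonneg_of_le (fun i => by positivity) (fun i => ?_) (hf.add hg)
  nlinarith [sq_nonneg (‖f i‖ - ‖g i‖), sq_nonneg (‖f i‖), sq_nonneg (‖g i‖)]

theorem SqSummable.of_norm_le {f g : ι → H} (hf : SqSummable f) (h : ∀ i, ‖g i‖ ≤ ‖f i‖) :
    SqSummable g :=
  Summable.of_nonneg_of_le (fun i => by positivity)
    (fun i => pow_le_pow_left₀ (norm_nonneg _) (h i) 2) hf

variable [InnerProductSpace ℂ H]

/-- The functional `T ↦ (T f, g)` on bounded operators. -/
noncomputable def vectorFunctional (f g : H) : (H →L[ℂ] H) →L[ℂ] ℂ :=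
  (innerSL ℂ g) ∘L ContinuousLinearMap.apply ℂ H f

theorem vectorFunctional_apply (f g : H) (T : H →L[ℂ] H) :
    vectorFunctional f g T = inner ℂ g (T f) := rfl

theorem norm_inner_apply_le (f g : H) (T : H →L[ℂ] H) :
    ‖inner ℂ g (T f)‖ ≤ ‖T‖ * (‖f‖ * ‖g‖) :=
  calc ‖inner ℂ g (T f)‖ ≤ ‖g‖ * (‖T‖ * ‖f‖) :=
        (norm_inner_le_norm _ _).trans (by gcongr; exact T.le_opNorm _)
    _ = ‖T‖ * (‖f‖ * ‖g‖) := by ring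

theorem norm_vectorFunctional_le (f g : H) : ‖vectorFunctional f g‖ ≤ ‖f‖ * ‖g‖ := by
  refine ContinuousLinearMap.opNorm_le_bound _ (by positivity) fun T => ?_
  rw [vectorFunctional_apply, mul_comm]
  exact norm_inner_apply_le f g T

/-- The functional `T ↦ ∑ i, (T fᵢ, gᵢ)` on bounded operators. -/
noncomputable def pairing (f g : ι → H) : (H →L[ℂ] H) →L[ℂ] ℂ :=
  ∑' i, vectorFunctional (f i) (g i)

theorem hasSum_dual_apply {E : Type*} [NormedAddCommGroup E] [NormedSpace ℂ E]
    {F : ι → E →L[ℂ] ℂ} {u : ι → ℝ} (hu : Summable u) (hF : ∀ i, ‖F i‖ ≤ u i) (T : E) :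
    HasSum (fun i => F i T) ((∑' i, F i) T) :=
  (Summable.of_norm_bounded hu hF).hasSum.mapL (ContinuousLinearMap.apply ℂ ℂ T)

theorem hasSum_pairing {f g : ι → H} (hf : SqSummable f) (hg : SqSummable g) (T : H →L[ℂ] H) :
    HasSum (fun i => inner ℂ (g i) (T (f i))) (pairing f g T) :=
  hasSum_dual_apply (hf.mul hg) (fun i => norm_vectorFunctional_le (f i) (g i)) T

theorem pairing_apply {f g : ι → H} (hf : SqSummable f) (hg : SqSummable g) (T : H →L[ℂ] H) :
    pairing f g T = ∑' i, inner ℂ (g i) (T (f i)) :=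
  (hasSum_pairing hf hg T).tsum_eq.symm

/-- Any pairing over a countable index type is a pairing with an element of the predual. -/
theorem exists_predualPairing_eq [Countable ι] {f g : ι → H} (hf : SqSummable f)
    (hg : SqSummable g) :
    ∃ f' g' : lp (fun _ : ℕ => H) 2, ∀ T, predualPairing f' g' T = pairing f g T := by
  obtain ⟨e, he⟩ := exists_injective_nat ι
  have key : ∀ {f : ι → H}, SqSummable f → SqSummable (Function.extend e f 0) := by
    intro f hf
    refine (he.summable_iff fun x hx => ?_).1 ?_
    · simp [Function.extend_apply' _ _ _ (by simpa using hx)]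
    · simpa [Function.comp_def, he.extend_apply, SqSummable] using hf
  refine ⟨⟨_, (key hf).memℓp⟩, ⟨_, (key hg).memℓp⟩, fun T => ?_⟩
  rw [pairing_apply hf hg, predualPairing]
  rw [← he.tsum_eq]
  · simp [he.extend_apply]
  · intro x hx
    by_contra h
    refine hx ?_
    simp [Function.extend_apply' _ _ _ (by simpa using h)]

theorem predualPairing_eq_pairing (f g : lp (fun _ : ℕ => H) 2) (T : H →L[ℂ] H) :
    predualPairing f g T = pairing f g T :=
  (pairing_apply (lp.sqSummable f) (lp.sqSummable g) T).symm

theorem continuous_weakStar_pairing [Countable ι] {f g : ι → H} (hf : SqSummable f)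
    (hg : SqSummable g) : Continuous[weakStarTopology H, _] (pairing f g) := by
  obtain ⟨f', g', h⟩ := exists_predualPairing_eq hf hg
  have : (pairing f g : (H →L[ℂ] H) → ℂ) = predualPairing f' g' := by ext T; rw [h]
  rw [this]
  exact continuous_iInf_dom (i := (f', g')) continuous_induced_dom

/-- A pairing vanishing on a set vanishes on its weak* closure. -/
theorem pairing_eq_zero_of_mem_closure [Countable ι] {f g : ι → H} (hf : SqSummable f)
    (hg : SqSummable g) {s : Set (H →L[ℂ] H)} (hs : ∀ T ∈ s, pairing f g T = 0)
    {T : H →L[ℂ] H} (hT : T ∈ closure[weakStarTopology H] s) : pairing f g T = 0 := by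
  have hc : @IsClosed _ (weakStarTopology H) (pairing f g ⁻¹' {0}) :=
    @IsClosed.preimage _ _ (weakStarTopology H) _ _ (continuous_weakStar_pairing hf hg) _
      isClosed_singleton
  have h : closure[weakStarTopology H] s ⊆ pairing f g ⁻¹' {0} :=
    @closure_minimal _ (weakStarTopology H) _ _ hs hc
  exact h hT

/-- The norm topology is finer than the weak* topology. -/
theorem norm_le_weakStarTopology :
    (inferInstance : TopologicalSpace (H →L[ℂ] H)) ≤ weakStarTopology H := by
  refine le_iInf fun h => ?_
  rw [← continuous_iff_le_induced]
  have : predualPairing h.1 h.2 = (pairing (H := H) h.1 h.2 : (H →L[ℂ] H) → ℂ) := by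
    ext T; rw [predualPairing_eq_pairing]
  rw [this]
  exact (pairing _ _).continuous

/-- An operator outside a weak* closed subspace is separated from it by a pairing. -/
theorem exists_pairing_of_notMem {U : Submodule ℂ (H →L[ℂ] H)}
    (hU : IsClosed[weakStarTopology H] (U : Set (H →L[ℂ] H))) {R : H →L[ℂ] H} (hR : R ∉ U) :
    ∃ f g : ℕ → H, SqSummable f ∧ SqSummable g ∧ (∀ T ∈ U, pairing f g T = 0) ∧
      pairing f g R ≠ 0 := by
  have hn : (U : Set (H →L[ℂ] H))ᶜ ∈ @nhds _ (weakStarTopology H) R :=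
    @IsOpen.mem_nhds _ (weakStarTopology H) _ _
      (@IsClosed.isOpen_compl _ (weakStarTopology H) _ hU) hR
  rw [nhds_iInf, Filter.mem_iInf'] at hn
  obtain ⟨I, hI, W, hW, -, hUW, -⟩ := hn
  have := hI.fintype
  let Φ : (H →L[ℂ] H) →ₗ[ℂ] (I → ℂ) :=
    LinearMap.pi fun h => (pairing (H := H) h.1.1 h.1.2 : (H →L[ℂ] H) →ₗ[ℂ] ℂ)
  -- A basic neighbourhood of `R` missing `U` constrains only the finitely many pairings in `I`, so
  -- an element of `U` sharing these values with `R` would lie in it. Separation becomes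
  -- finite-dimensional.
  have hΦ : Φ R ∉ U.map Φ := by
    rintro ⟨S, hS, hSR⟩
    have : S ∈ (U : Set (H →L[ℂ] H))ᶜ := by
      rw [hUW]
      refine Set.mem_iInter₂.2 fun h hh => ?_
      have h1 := hW h
      rw [nhds_induced] at h1
      obtain ⟨t, ht, htW⟩ := h1
      refine htW ?_
      have h2 : pairing (H := H) h.1 h.2 S = pairing (H := H) h.1 h.2 R := congrFun hSR ⟨h, hh⟩
      rw [Set.mem_preimage, predualPairing_eq_pairing, h2, ← predualPairing_eq_pairing]
      exact mem_of_mem_nhds ht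
    exact this hS
  obtain ⟨ψ, hψR, hψU⟩ := Submodule.exists_le_ker_of_notMem hΦ
  classical
  let c : I → ℂ := fun h => ψ fun j => if h = j then 1 else 0
  have hψ : ∀ T, ψ (Φ T) = ∑ h : I, c h * pairing (H := H) h.1.1 h.1.2 T := by
    intro T
    rw [LinearMap.pi_apply_eq_sum_univ ψ]
    exact Finset.sum_congr rfl fun h _ => by
      rw [mul_comm]; rfl
  -- Concatenating the sequences, with the coefficients absorbed into `f`, turns a finite
  -- combination of pairings into one pairing.
  let f : I × ℕ → H := fun x => c x.1 • x.1.1.1 x.2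
  let g : I × ℕ → H := fun x => x.1.1.2 x.2
  have hf : SqSummable f := by
    refine (summable_prod_of_nonneg fun _ => by positivity).2 ⟨fun h => ?_, ?_⟩
    · simp only [f, norm_smul, mul_pow]
      exact (lp.sqSummable h.1.1).mul_left _
    · exact (hasSum_fintype _).summable
  have hg : SqSummable g := by
    refine (summable_prod_of_nonneg fun _ => by positivity).2 ⟨fun h => ?_, ?_⟩
    · exact lp.sqSummable h.1.2
    · exact (hasSum_fintype _).summable
  have hfg : ∀ T, pairing f g T = ψ (Φ T) := by
    intro T
    rw [hψ, pairing_apply hf hg, (hasSum_pairing hf hg T).summable.tsum_prod, tsum_fintype]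
    refine Finset.sum_congr rfl fun h _ => ?_
    rw [pairing_apply (lp.sqSummable _) (lp.sqSummable _), ← tsum_mul_left]
    simp [f, g]
  obtain ⟨f', g', h⟩ := exists_predualPairing_eq hf hg
  refine ⟨f', g', lp.sqSummable _, lp.sqSummable _, fun T hT => ?_, ?_⟩
  · rw [← predualPairing_eq_pairing, h, hfg]
    exact hψU (Submodule.mem_map_of_mem hT)
  · rw [← predualPairing_eq_pairing, h, hfg]
    exact hψR

/-- Pairings pass to the limit along strongly convergent contractive cutoffs. -/
theorem tendsto_pairing_comp {f g : ι → H} (hf : SqSummable f) (hg : SqSummable g)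
    {M : ℕ → H →L[ℂ] H} (hM : ∀ n ξ, ‖M n ξ‖ ≤ ‖ξ‖)
    (hlim : ∀ ξ, Filter.Tendsto (fun n => M n ξ) Filter.atTop (𝓝 ξ)) (T : H →L[ℂ] H) :
    Filter.Tendsto (fun n => pairing (fun i => M n (f i)) (fun i => M n (g i)) T)
      Filter.atTop (𝓝 (pairing f g T)) := by
  have h1 : ∀ n, pairing (fun i => M n (f i)) (fun i => M n (g i)) T =
      ∑' i, inner ℂ (M n (g i)) (T (M n (f i))) := fun n =>
    pairing_apply (hf.of_norm_le fun i => hM n _) (hg.of_norm_le fun i => hM n _) T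
  simp only [h1, pairing_apply hf hg]
  refine tendsto_tsum_of_dominated_convergence ((hf.mul hg).mul_left ‖T‖) (fun i => ?_) ?_
  · exact (hlim (g i)).inner ((T.continuous.tendsto _).comp (hlim (f i)))
  · refine Filter.Eventually.of_forall fun n i => ?_
    refine (norm_inner_apply_le _ _ T).trans ?_
    gcongr <;> exact hM _ _

/-- The rank-one operators span a norm dense subspace of the compact operators. -/
theorem mem_closure_span_rankOne [CompleteSpace H] {T : H →L[ℂ] H} (hT : IsCompactOperator T) :
    T ∈ (Submodule.span ℂ (Set.range fun x : H × H => rankOne ℂ x.1 x.2)).topologicalClosure := by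
  refine Metric.mem_closure_iff.2 fun ε hε => ?_
  have htb : TotallyBounded (T '' Metric.closedBall 0 1) :=
    (hT.isCompact_closure_image_closedBall 1).totallyBounded.subset subset_closure
  obtain ⟨t, htf, ht⟩ := Metric.totallyBounded_iff.1 htb (ε / 2) (half_pos hε)
  -- Projecting onto the span of a finite `ε / 2`-net of the image of the unit ball gives a
  -- finite-rank approximant, since the projection is the nearest point of `E`.
  let E := Submodule.span ℂ t
  have : FiniteDimensional ℂ E := FiniteDimensional.span_of_finite ℂ htf
  refine ⟨E.starProjection ∘L T, ?_, ?_⟩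
  · rw [(stdOrthonormalBasis ℂ E).starProjection_eq_sum_rankOne]
    rw [ContinuousLinearMap.finsetSum_comp]
    refine Submodule.sum_mem _ fun i _ => ?_
    rw [rankOne_comp]
    exact Submodule.subset_span ⟨(_, _), rfl⟩
  · rw [dist_eq_norm]
    refine lt_of_le_of_lt (ContinuousLinearMap.opNorm_le_of_unit_norm (C := ε / 2)
      (half_pos hε).le fun ξ hξ => ?_) (half_lt_self hε)
    obtain ⟨y, hy, hyb⟩ := Set.mem_iUnion₂.1 (ht ⟨ξ, by simp [hξ], rfl⟩)
    have hm := E.starProjection_minimal (y := T ξ)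
    rw [sub_apply, ContinuousLinearMap.comp_apply]
    rw [hm]
    refine (ciInf_le ⟨0, ?_⟩ (⟨y, Submodule.subset_span hy⟩ : E)).trans ?_
    · rintro _ ⟨x, rfl⟩; positivity
    · rw [Metric.mem_ball, dist_eq_norm] at hyb
      exact hyb.le

end Pairing

/-! ### Polar decomposition and the dual of the compact operators -/

section TraceClass

open InnerProductSpace ContinuousLinearMap

variable {H : Type*} [NormedAddCommGroup H] [InnerProductSpace ℂ H]

theorem norm_sum_rankOne_le_one {ι : Type*} {e : ι → H} (he : Orthonormal ℂ e) (t : Finset ι) :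
    ‖∑ i ∈ t, rankOne ℂ (e i) (e i)‖ ≤ 1 := by
  refine opNorm_le_bound _ zero_le_one fun x => ?_
  rw [one_mul]
  refine le_of_sq_le_sq ?_ (norm_nonneg _)
  have h : ‖∑ i ∈ t, inner ℂ (e i) x • e i‖ ^ 2 = ∑ i ∈ t, ‖inner ℂ (e i) x‖ ^ 2 := by
    have := he.inner_sum (fun i => inner ℂ (e i) x) (fun i => inner ℂ (e i) x) t
    rw [inner_self_eq_norm_sq_to_K] at this
    simp only [RCLike.conj_mul] at this
    exact_mod_cast this
  simp only [FunLike.coe_sum, Finset.sum_apply, rankOne_apply]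
  rw [h]
  exact he.sum_inner_products_le x

variable [CompleteSpace H]

theorem norm_cfcAbs_apply (C : H →L[ℂ] H) (x : H) : ‖CFC.abs C x‖ = ‖C x‖ := by
  have hsa : IsSelfAdjoint (CFC.abs C) := IsSelfAdjoint.of_nonneg (CFC.abs_nonneg C)
  have h : (CFC.abs C) ((CFC.abs C) x) = (star C) (C x) := by
    have := congrArg (fun T : H →L[ℂ] H => T x) (CFC.abs_mul_abs C)
    simpa using this
  have h2 : inner ℂ (CFC.abs C x) (CFC.abs C x) = inner ℂ (C x) (C x) := by
    rw [← adjoint_inner_right, ← star_eq_adjoint, hsa.star_eq, h, star_eq_adjoint,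
      adjoint_inner_right]
  rw [inner_self_eq_norm_sq_to_K, inner_self_eq_norm_sq_to_K] at h2
  have h3 : ‖CFC.abs C x‖ ^ 2 = ‖C x‖ ^ 2 := by exact_mod_cast h2
  exact (sq_eq_sq₀ (norm_nonneg _) (norm_nonneg _)).1 h3

/-- The polar decomposition of a bounded operator. -/
theorem exists_polar_decomposition (C : H →L[ℂ] H) :
    ∃ V : H →L[ℂ] H, ‖V‖ ≤ 1 ∧ V * CFC.abs C = C ∧ star V * C = CFC.abs C := by
  set P := CFC.abs C with hP
  let N : Submodule ℂ H := P.range.topologicalClosure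
  have hPN : ∀ x, P x ∈ N := fun x => Submodule.le_topologicalClosure _ ⟨x, rfl⟩
  let e : H →ₗ[ℂ] N := P.toLinearMap.codRestrict N hPN
  have he : DenseRange e := by
    intro y
    refine Metric.mem_closure_iff.2 fun ε hε => ?_
    obtain ⟨_, ⟨x, rfl⟩, hx⟩ := Metric.mem_closure_iff.1 y.2 ε hε
    exact ⟨_, ⟨x, rfl⟩, hx⟩
  -- Since `‖P x‖ = ‖C x‖`, the map `P x ↦ C x` is well defined and isometric, so it extends to the
  -- closed range of `P`.
  have hb : ∀ x, ‖C.toLinearMap x‖ ≤ 1 * ‖e x‖ := by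
    intro x
    rw [one_mul]
    exact (norm_cfcAbs_apply C x).ge
  have : CompleteSpace N := P.range.isClosed_topologicalClosure.completeSpace_coe
  let V : H →L[ℂ] H := (C.toLinearMap.extendOfNorm e) ∘L N.orthogonalProjectionOnto
  have hVn : ∀ x, ‖V x‖ ≤ ‖x‖ := by
    intro x
    calc ‖V x‖ ≤ 1 * ‖N.orthogonalProjectionOnto x‖ :=
          LinearMap.norm_extendOfNorm_apply_le he 1 hb _
      _ ≤ ‖x‖ := by rw [one_mul]; exact N.norm_orthogonalProjectionOnto_apply_le x
  have hVP : ∀ x, V (P x) = C x := by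
    intro x
    have h1 : N.orthogonalProjectionOnto (P x) = e x :=
      N.orthogonalProjectionOnto_mem_subspace_eq_self (e x)
    change C.toLinearMap.extendOfNorm e (N.orthogonalProjectionOnto (P x)) = _
    rw [h1, LinearMap.extendOfNorm_eq he ⟨1, hb⟩]
    rfl
  have hV1 : ‖V‖ ≤ 1 := opNorm_le_bound _ zero_le_one fun x => by simpa using hVn x
  refine ⟨V, hV1, by ext x; exact hVP x, ?_⟩
  ext x
  -- On expansion the cross term is `-2‖C x‖²`, while each square is at most `‖C x‖²`.
  have hn : ‖(star V) (C x) - P x‖ ^ 2 ≤ 0 := by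
    rw [@norm_sub_sq ℂ]
    have h1 : inner ℂ ((star V) (C x)) (P x) = inner ℂ (C x) (C x) := by
      rw [star_eq_adjoint, adjoint_inner_left, hVP]
    have h2 : ‖(star V) (C x)‖ ≤ ‖C x‖ := by
      refine ((star V).le_opNorm _).trans ?_
      rw [norm_star]
      exact mul_le_of_le_one_left (norm_nonneg _) hV1
    rw [h1, inner_self_eq_norm_sq, norm_cfcAbs_apply]
    nlinarith [norm_nonneg ((star V) (C x))]
  have := pow_eq_zero_iff (two_ne_zero) |>.1 (le_antisymm hn (by positivity))
  exact sub_eq_zero.1 (norm_eq_zero.1 this)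

/-- The restriction of a bounded functional on `B(H)` to the compact operators is given by a
pairing with an element of the predual. -/
theorem exists_pairing_eq_on_compacts (φ : (H →L[ℂ] H) →L[ℂ] ℂ) :
    ∃ f g : ℕ → H, SqSummable f ∧ SqSummable g ∧
      ∀ T : H →L[ℂ] H, IsCompactOperator T → φ T = pairing f g T := by
  obtain ⟨C, hC⟩ : ∃ C : H →L[ℂ] H, ∀ x y, φ (rankOne ℂ x y) = inner ℂ (C y) x := by
    let B : H →L⋆[ℂ] H →L[ℂ] ℂ := (compL ℂ H (H →L[ℂ] H) ℂ φ) ∘SL (rankOne ℂ).flip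
    exact ⟨continuousLinearMapOfBilin B, fun x y => by
      rw [continuousLinearMapOfBilin_apply]; rfl⟩
  obtain ⟨V, hV, hVC, hVs⟩ := exists_polar_decomposition C
  set P := CFC.abs C
  have hP : 0 ≤ P := CFC.abs_nonneg C
  -- Writing `C = V R R` splits the trace-class operator into two Hilbert–Schmidt factors, which
  -- supply the sequences `R bᵢ` and `V R bᵢ`.
  set R := CFC.sqrt P
  have hRP : R * R = P := CFC.sqrt_mul_sqrt_self P
  have hR : star R = R := (IsSelfAdjoint.of_nonneg (CFC.sqrt_nonneg P)).star_eq
  have hRi : ∀ x y, inner ℂ (R x) y = inner ℂ x (R y) := by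
    intro x y
    rw [← adjoint_inner_right, ← star_eq_adjoint, hR]
  obtain ⟨w, b, hb⟩ := exists_hilbertBasis ℂ H
  have hRb : ∀ i, ((‖R (b i)‖ ^ 2 : ℝ) : ℂ) = φ (rankOne ℂ (V (b i)) (b i)) := by
    intro i
    rw [hC, ← adjoint_inner_left, ← star_eq_adjoint]
    have : (star V) (C (b i)) = R (R (b i)) := by
      exact (DFunLike.congr_fun hVs (b i)).trans (DFunLike.congr_fun hRP (b i)).symm
    rw [this, hRi, inner_self_eq_norm_sq_to_K]
    simp
  have hsum : SqSummable fun i => R (b i) := by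
    refine summable_of_sum_le (c := ‖φ‖) (fun i => by positivity) fun t => ?_
    -- Partial sums of the trace of `P` are values of `φ` at contractions, so `‖φ‖` bounds them all.
    have h1 : ((∑ i ∈ t, ‖R (b i)‖ ^ 2 : ℝ) : ℂ) =
        φ (V ∘L ∑ i ∈ t, rankOne ℂ (b i) (b i)) := by
      rw [comp_finsetSum, map_sum]
      push_cast
      refine Finset.sum_congr rfl fun i _ => ?_
      rw [comp_rankOne, ← hRb]
      push_cast; rfl
    have h2 : ‖((∑ i ∈ t, ‖R (b i)‖ ^ 2 : ℝ) : ℂ)‖ ≤ ‖φ‖ := by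
      rw [h1]
      refine (φ.le_opNorm _).trans (mul_le_of_le_one_right (norm_nonneg _) ?_)
      refine (opNorm_comp_le _ _).trans (mul_le_one₀ hV (norm_nonneg _) ?_)
      exact norm_sum_rankOne_le_one b.orthonormal t
    rw [Complex.norm_real] at h2
    exact (le_abs_self _).trans h2
  have hsumV : SqSummable fun i => V (R (b i)) := hsum.of_norm_le fun i =>
    (V.le_opNorm _).trans (mul_le_of_le_one_left (norm_nonneg _) hV)
  -- The space may be nonseparable; only countably many basis vectors contribute.
  let S : Set w := {i | R (b i) ≠ 0}
  have hS : S.Countable := hsum.countable_support.mono fun i hi => by simpa [S] using hi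
  have : Countable S := hS
  let f : S → H := fun i => R (b i)
  let g : S → H := fun i => V (R (b i))
  have hf : SqSummable f := hsum.comp_injective Subtype.val_injective
  have hg : SqSummable g := hsumV.comp_injective Subtype.val_injective
  have hrank : ∀ x y, φ (rankOne ℂ x y) = pairing f g (rankOne ℂ x y) := by
    intro x y
    have h1 : C y = V (R (R y)) := by
      rw [show R (R y) = P y from DFunLike.congr_fun hRP y]
      exact (DFunLike.congr_fun hVC y).symm
    rw [hC, pairing_apply hf hg, h1, ← adjoint_inner_right, hRi,
      ← b.tsum_inner_mul_inner]
    have hterm : ∀ i, inner ℂ (R y) (b i) * inner ℂ (b i) (R ((adjoint V) x)) =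
        inner ℂ (V (R (b i))) (rankOne ℂ x y (R (b i))) := by
      intro i
      rw [rankOne_apply, inner_smul_right, hRi, ← hRi (b i), adjoint_inner_right]
    rw [← tsum_subtype_eq_of_support_subset (s := S)]
    · exact tsum_congr fun i => hterm i
    · intro i hi h0
      refine hi ?_
      exact (hterm i).trans (by simp [h0])
  obtain ⟨f', g', h⟩ := exists_predualPairing_eq hf hg
  refine ⟨f', g', lp.sqSummable _, lp.sqSummable _, fun T hT => ?_⟩
  have hcl : (Submodule.span ℂ (Set.range fun x : H × H => rankOne ℂ x.1 x.2)).topologicalClosure ≤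
      LinearMap.ker ((φ - pairing f' g' : (H →L[ℂ] H) →L[ℂ] ℂ) : (H →L[ℂ] H) →ₗ[ℂ] ℂ) := by
    refine Submodule.topologicalClosure_minimal _ ?_ (φ - pairing f' g').isClosed_ker
    rw [Submodule.span_le]
    rintro _ ⟨⟨x, y⟩, rfl⟩
    change φ (rankOne ℂ x y) - pairing f' g' (rankOne ℂ x y) = 0
    rw [← predualPairing_eq_pairing, h, hrank, sub_self]
  exact sub_eq_zero.1 (hcl (mem_closure_span_rankOne hT))

end TraceClass

/-! ### Bounded columns and their action on compact operators -/

section Column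

open InnerProductSpace ContinuousLinearMap

variable {H : Type*} [NormedAddCommGroup H] [InnerProductSpace ℂ H]

/-- The sequence `A` defines a bounded operator `η ↦ (Aᵢ η)ᵢ` from `H` to `ℓ²(H)`. -/
def IsBoundedColumn (A : ℕ → H →L[ℂ] H) : Prop :=
  ∃ C : ℝ, 0 ≤ C ∧ ∀ (η : H) (t : Finset ℕ), ∑ i ∈ t, ‖A i η‖ ^ 2 ≤ C * ‖η‖ ^ 2

theorem IsBoundedColumn.sqSummable {A : ℕ → H →L[ℂ] H} (hA : IsBoundedColumn A) (η : H) :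
    SqSummable fun i => A i η := by
  obtain ⟨C, -, hC⟩ := hA
  exact summable_of_sum_le (fun i => by positivity) (hC η)

theorem IsBoundedColumn.sqSummable_prod {A : ℕ → H →L[ℂ] H} (hA : IsBoundedColumn A)
    {f : ℕ → H} (hf : SqSummable f) : SqSummable fun x : ℕ × ℕ => A x.1 (f x.2) := by
  have h : SqSummable fun x : ℕ × ℕ => A x.2 (f x.1) := by
    refine (summable_prod_of_nonneg fun _ => by positivity).2
      ⟨fun j => hA.sqSummable (f j), ?_⟩
    obtain ⟨C, -, hC⟩ := hA
    exact Summable.of_nonneg_of_le (fun j => tsum_nonneg fun i => by positivity)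
      (fun j => Real.tsum_le_of_sum_le (fun i => by positivity) (hC (f j))) (hf.mul_left C)
  exact h.prod_symm

variable [CompleteSpace H]

/-- The operator `∑ i, Bᵢ* T Aᵢ`. -/
noncomputable def columnSum (A B : ℕ → H →L[ℂ] H) (T : H →L[ℂ] H) : H →L[ℂ] H :=
  ∑' i, adjoint (B i) ∘L T ∘L A i

/-- Cauchy–Schwarz over `i`. Uniformity in the finite set `t` is what lets summability pass from
finite-rank to compact operators. -/
theorem exists_norm_sum_adjoint_comp_le {A B : ℕ → H →L[ℂ] H} (hA : IsBoundedColumn A)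
    (hB : IsBoundedColumn B) : ∃ C : ℝ, 0 ≤ C ∧ ∀ (T : H →L[ℂ] H) (t : Finset ℕ),
      ‖∑ i ∈ t, adjoint (B i) ∘L T ∘L A i‖ ≤ C * ‖T‖ := by
  obtain ⟨a, ha, hA⟩ := hA
  obtain ⟨b, hb, hB⟩ := hB
  refine ⟨√b * √a, by positivity, fun T t => ?_⟩
  refine opNorm_le_bound _ (by positivity) fun ξ => ?_
  set S := ∑ i ∈ t, adjoint (B i) ∘L T ∘L A i with hS
  have hsqrt : ∀ {c : ℝ} (ζ : H) {D : ℕ → H →L[ℂ] H},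
      ∑ i ∈ t, ‖D i ζ‖ ^ 2 ≤ c * ‖ζ‖ ^ 2 → √(∑ i ∈ t, ‖D i ζ‖ ^ 2) ≤ √c * ‖ζ‖ := by
    intro c ζ D h
    refine (Real.sqrt_le_sqrt h).trans_eq ?_
    rw [Real.sqrt_mul' _ (by positivity), Real.sqrt_sq (norm_nonneg _)]
  have key : ∀ η, ‖inner ℂ η (S ξ)‖ ≤ √b * √a * ‖T‖ * ‖ξ‖ * ‖η‖ := by
    intro η
    have h1 : inner ℂ η (S ξ) = ∑ i ∈ t, inner ℂ (B i η) (T (A i ξ)) := by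
      simp [hS, adjoint_inner_right]
    calc ‖inner ℂ η (S ξ)‖ ≤ ∑ i ∈ t, ‖T‖ * (‖B i η‖ * ‖A i ξ‖) := by
          rw [h1]
          refine (norm_sum_le _ _).trans (Finset.sum_le_sum fun i _ => ?_)
          rw [mul_comm ‖B i η‖]
          exact norm_inner_apply_le _ _ T
      _ = ‖T‖ * ∑ i ∈ t, ‖B i η‖ * ‖A i ξ‖ := by rw [Finset.mul_sum]
      _ ≤ ‖T‖ * (√(∑ i ∈ t, ‖B i η‖ ^ 2) * √(∑ i ∈ t, ‖A i ξ‖ ^ 2)) := by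
          gcongr
          exact Real.sum_mul_le_sqrt_mul_sqrt _ _ _
      _ ≤ ‖T‖ * ((√b * ‖η‖) * (√a * ‖ξ‖)) := by
          gcongr
          · exact hsqrt η (hB η t)
          · exact hsqrt ξ (hA ξ t)
      _ = √b * √a * ‖T‖ * ‖ξ‖ * ‖η‖ := by ring
  have h2 := key (S ξ)
  rw [inner_self_eq_norm_sq_to_K, norm_pow, RCLike.norm_ofReal, abs_norm, sq] at h2
  rcases (norm_nonneg (S ξ)).eq_or_lt with h0 | h0
  · rw [← h0]; positivity
  · exact le_of_mul_le_mul_right h2 h0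

/-- For a rank-one operator the norms of the terms are products of two square summable sequences,
which is where the adjoint columns enter. The uniform bound and density extend this to compact
operators; for general `T` the series need not converge in norm. -/
theorem summable_adjoint_comp {A B : ℕ → H →L[ℂ] H} (hA : IsBoundedColumn A)
    (hB : IsBoundedColumn B) (hA' : IsBoundedColumn fun i => adjoint (A i))
    (hB' : IsBoundedColumn fun i => adjoint (B i)) {T : H →L[ℂ] H} (hT : IsCompactOperator T) :
    Summable fun i => adjoint (B i) ∘L T ∘L A i := by
  have hspan : ∀ F ∈ Submodule.span ℂ (Set.range fun x : H × H => rankOne ℂ x.1 x.2),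
      Summable fun i => adjoint (B i) ∘L F ∘L A i := by
    intro F hF
    induction hF using Submodule.span_induction with
    | mem F hF =>
      obtain ⟨⟨x, y⟩, rfl⟩ := hF
      refine Summable.of_norm_bounded ((hB'.sqSummable x).mul (hA'.sqSummable y)) fun i => ?_
      simp only
      rw [rankOne_comp, comp_rankOne, norm_rankOne]
    | zero => simp
    | add F G _ _ hF hG => simpa [add_comp, comp_add] using hF.add hG
    | smul c F _ hF => simpa [smul_comp, comp_smul] using hF.const_smul c
  obtain ⟨C, hC, hbound⟩ := exists_norm_sum_adjoint_comp_le hA hB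
  rw [summable_iff_vanishing_norm]
  intro ε hε
  -- The `+ 1` keeps the denominator positive when `C = 0`.
  obtain ⟨F, hF, hTF⟩ := Metric.mem_closure_iff.1 (mem_closure_span_rankOne hT)
    (ε / 2 / (C + 1)) (by positivity)
  obtain ⟨s, hs⟩ := summable_iff_vanishing_norm.1 (hspan F hF) (ε / 2) (half_pos hε)
  refine ⟨s, fun t ht => ?_⟩
  have h1 : ∑ i ∈ t, adjoint (B i) ∘L T ∘L A i =
      ∑ i ∈ t, adjoint (B i) ∘L (T - F) ∘L A i + ∑ i ∈ t, adjoint (B i) ∘L F ∘L A i := by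
    rw [← Finset.sum_add_distrib]
    refine Finset.sum_congr rfl fun i _ => ?_
    rw [← comp_add, ← add_comp, sub_add_cancel]
  have h2 : C * ‖T - F‖ ≤ ε / 2 := by
    rw [dist_eq_norm, lt_div_iff₀ (by positivity)] at hTF
    nlinarith [norm_nonneg (T - F)]
  rw [h1]
  refine (norm_add_le _ _).trans_lt ?_
  linarith [hbound (T - F) t, hs t ht]

theorem isCompactOperator_columnSum {A B : ℕ → H →L[ℂ] H}
    (hA : IsBoundedColumn A) (hB : IsBoundedColumn B)
    (hA' : IsBoundedColumn fun i => adjoint (A i)) (hB' : IsBoundedColumn fun i => adjoint (B i))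
    {T : H →L[ℂ] H} (hT : IsCompactOperator T) :
    IsCompactOperator (columnSum A B T) := by
  refine isCompactOperator_of_tendsto (summable_adjoint_comp hA hB hA' hB' hT).hasSum
    (Filter.Eventually.of_forall fun t => ?_)
  exact (compacts H).sum_mem fun i _ => (hT.comp_clm (A i)).clm_comp (adjoint (B i))

theorem hasSum_inner_columnSum {A B : ℕ → H →L[ℂ] H}
    (hA : IsBoundedColumn A) (hB : IsBoundedColumn B)
    (hA' : IsBoundedColumn fun i => adjoint (A i)) (hB' : IsBoundedColumn fun i => adjoint (B i))
    {T : H →L[ℂ] H} (hT : IsCompactOperator T)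
    (ξ η : H) :
    HasSum (fun i => inner ℂ (B i η) (T (A i ξ))) (inner ℂ η (columnSum A B T ξ)) := by
  have := (summable_adjoint_comp hA hB hA' hB' hT).hasSum.mapL (vectorFunctional ξ η)
  simpa [vectorFunctional_apply, adjoint_inner_right, columnSum] using this

/-- The duality between acting on operators and multiplying kernels: the double series is summable,
so it may be regrouped by the index of `f` and `g`. -/
theorem pairing_columnSum {A B : ℕ → H →L[ℂ] H}
    (hA : IsBoundedColumn A) (hB : IsBoundedColumn B)
    (hA' : IsBoundedColumn fun i => adjoint (A i)) (hB' : IsBoundedColumn fun i => adjoint (B i))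
    {T : H →L[ℂ] H} (hT : IsCompactOperator T)
    {f g : ℕ → H} (hf : SqSummable f) (hg : SqSummable g) :
    pairing f g (columnSum A B T) =
      pairing (fun x : ℕ × ℕ => A x.1 (f x.2)) (fun x : ℕ × ℕ => B x.1 (g x.2)) T := by
  have h := hasSum_pairing (hA.sqSummable_prod hf) (hB.sqSummable_prod hg) T
  have h2 := (Equiv.prodComm ℕ ℕ).hasSum_iff.2 h
  have h3 := h2.prod_fiberwise fun j => hasSum_inner_columnSum hA hB hA' hB' hT (f j) (g j)
  exact (hasSum_pairing hf hg _).unique h3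

/-- Grouping by the column index instead makes every inner sum one of the vanishing pairings. -/
theorem pairing_prod_eq_zero {A B : ℕ → H →L[ℂ] H} (hA : IsBoundedColumn A)
    (hB : IsBoundedColumn B) {f g : ℕ → H} (hf : SqSummable f) (hg : SqSummable g)
    {T : H →L[ℂ] H} (h0 : ∀ i, pairing f g (adjoint (B i) ∘L T ∘L A i) = 0) :
    pairing (fun x : ℕ × ℕ => A x.1 (f x.2)) (fun x : ℕ × ℕ => B x.1 (g x.2)) T = 0 := by
  have h := hasSum_pairing (hA.sqSummable_prod hf) (hB.sqSummable_prod hg) T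
  have h3 : HasSum (fun _ : ℕ => (0 : ℂ)) _ := h.prod_fiberwise fun i => by
    have := hasSum_pairing hf hg (adjoint (B i) ∘L T ∘L A i)
    rw [h0] at this
    simpa [adjoint_inner_right] using this
  exact h3.unique hasSum_zero

end Column

/-! ### Multiplication operators, bounded kernels and cutoffs -/

section Multiplication

open ContinuousLinearMap

variable {X : Type*} [MeasurableSpace X] {μ : Measure X}

theorem Lp_two_enorm_sq (ξ : Lp ℂ 2 μ) : ‖ξ‖ₑ ^ 2 = ∫⁻ x, ‖ξ x‖ₑ ^ 2 ∂μ := by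
  have := eLpNorm_nnreal_pow_eq_lintegral (f := ξ) (μ := μ) (p := 2) two_ne_zero
  rw [Lp.enorm_def]
  simpa using this

theorem adjoint_mulOp (a : Lp ℂ ∞ μ) : adjoint (mulOp μ a) = mulOp μ (star a) := by
  symm
  rw [eq_adjoint_iff]
  intro ξ η
  rw [L2.inner_def, L2.inner_def]
  refine integral_congr_ae ?_
  filter_upwards [coeFn_mulOp μ (star a) ξ, coeFn_mulOp μ a η, Lp.coeFn_star a] with x h1 h2 h3
  simp [h1, h2, h3]
  ring

theorem norm_mulOp_star (a : Lp ℂ ∞ μ) (ξ : Lp ℂ 2 μ) :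
    ‖mulOp μ (star a) ξ‖ = ‖mulOp μ a ξ‖ := by
  have h : ∀ᵐ x ∂μ, ‖mulOp μ (star a) ξ x‖ = ‖mulOp μ a ξ x‖ := by
    filter_upwards [coeFn_mulOp μ (star a) ξ, coeFn_mulOp μ a ξ, Lp.coeFn_star a] with x h1 h2 h3
    simp [h1, h2, h3]
  exact le_antisymm (Lp.norm_le_norm_of_ae_le (h.mono fun _ h => h.le))
    (Lp.norm_le_norm_of_ae_le (h.mono fun _ h => h.ge))

/-- Pointwise commutativity: a function in both spaces can serve as vector or as multiplier.
Commutativity of the product of kernels rests on this. -/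
theorem mulOp_swap {f f' : Lp ℂ 2 μ} {p p' : Lp ℂ ∞ μ} (h : f =ᵐ[μ] p) (h' : f' =ᵐ[μ] p') :
    mulOp μ p f' = mulOp μ p' f := by
  refine Lp.ext ?_
  filter_upwards [coeFn_mulOp μ p f', coeFn_mulOp μ p' f, h, h'] with x h1 h2 h3 h4
  rw [h1, h2, h3, h4, mul_comm]

/-- `f` is a square summable sequence in `L²`, consisting of the bounded functions `pᵢ`, such that
`∑ i, |pᵢ|²` is essentially bounded. -/
structure IsBoundedRep (f : ℕ → Lp ℂ 2 μ) (p : ℕ → Lp ℂ ∞ μ) : Prop where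
  sqSummable : SqSummable f
  ae_eq : ∀ i, f i =ᵐ[μ] p i
  column : IsBoundedColumn fun i => mulOp μ (p i)

theorem IsBoundedRep.column_adjoint {f : ℕ → Lp ℂ 2 μ} {p : ℕ → Lp ℂ ∞ μ}
    (h : IsBoundedRep f p) : IsBoundedColumn fun i => adjoint (mulOp μ (p i)) := by
  obtain ⟨C, hC, hb⟩ := h.column
  refine ⟨C, hC, fun η t => ?_⟩
  simpa only [adjoint_mulOp, norm_mulOp_star] using hb η t

/-- Real cutoffs `Mₙ` converging strongly to the identity and turning `f` and `g` into bounded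
sequences. -/
structure IsCutoff (M : ℕ → Lp ℂ ∞ μ) (f g : ℕ → Lp ℂ 2 μ) : Prop where
  exists_L2 : ∀ n, ∃ ξ : Lp ℂ 2 μ, ξ =ᵐ[μ] M n
  norm_le : ∀ n η, ‖mulOp μ (M n) η‖ ≤ ‖η‖
  tendsto : ∀ η, Filter.Tendsto (fun n => mulOp μ (M n) η) Filter.atTop (𝓝 η)
  adjoint_eq : ∀ n, adjoint (mulOp μ (M n)) = mulOp μ (M n)
  left : ∀ n, ∃ p, IsBoundedRep (fun i => mulOp μ (M n) (f i)) p
  right : ∀ n, ∃ p, IsBoundedRep (fun i => mulOp μ (M n) (g i)) p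

theorem lintegral_tsum_enorm_sq_lt_top {f : ℕ → Lp ℂ 2 μ} (hf : SqSummable f) :
    ∫⁻ x, ∑' i, ‖f i x‖ₑ ^ 2 ∂μ < ∞ := by
  rw [lintegral_tsum fun i => ((Lp.stronglyMeasurable (f i)).enorm.pow_const 2).aemeasurable]
  simp only [← Lp_two_enorm_sq]
  have h : ∀ i, ‖f i‖ₑ ^ 2 = ENNReal.ofReal (‖f i‖ ^ 2) := fun i => by
    rw [ENNReal.ofReal_pow (norm_nonneg _), ofReal_norm]
  simp only [h]
  exact hf.tsum_ofReal_lt_top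

theorem coeFn_mulOp_indicator {E : Set X} (hE : MeasurableSet E) (hμE : μ E ≠ ∞)
    (η : Lp ℂ 2 μ) :
    mulOp μ (indicatorConstLp ∞ hE hμE (1 : ℂ)) η =ᵐ[μ] E.indicator η := by
  filter_upwards [coeFn_mulOp μ (indicatorConstLp ∞ hE hμE (1 : ℂ)) η,
    indicatorConstLp_coeFn (p := ∞) (hs := hE) (hμs := hμE) (c := (1 : ℂ))] with x h1 h2
  rw [h1, h2]
  by_cases hx : x ∈ E <;> simp [hx]

/-- Cutting off to a set where `∑ i, |fᵢ|²` is bounded gives a bounded sequence. -/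
theorem exists_isBoundedRep_indicator {E : Set X} (hE : MeasurableSet E) (hμE : μ E ≠ ∞)
    {f : ℕ → Lp ℂ 2 μ} (hf : SqSummable f) {C : ℝ} (hC : 0 ≤ C)
    (h : ∀ x ∈ E, ∑' i, ‖f i x‖ₑ ^ 2 ≤ ENNReal.ofReal C) :
    ∃ p, IsBoundedRep (fun i => mulOp μ (indicatorConstLp ∞ hE hμE (1 : ℂ)) (f i)) p := by
  have hb : ∀ i x, ‖E.indicator (f i) x‖ ≤ √C := by
    intro i x
    by_cases hx : x ∈ E
    · rw [Set.indicator_of_mem hx]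
      refine Real.le_sqrt_of_sq_le ?_
      have := (ENNReal.le_tsum i).trans (h x hx)
      rw [← ofReal_norm, ← ENNReal.ofReal_pow (norm_nonneg _)] at this
      exact (ENNReal.ofReal_le_ofReal_iff hC).1 this
    · simp [Set.indicator_of_notMem hx]
  have hmem : ∀ i, MemLp (E.indicator (f i)) ∞ μ := fun i =>
    memLp_top_of_bound ((Lp.aestronglyMeasurable (f i)).indicator hE) _
      (Filter.Eventually.of_forall (hb i))
  refine ⟨fun i => (hmem i).toLp, ?_, fun i => ?_, C, hC, fun η t => ?_⟩
  · refine hf.of_norm_le fun i => Lp.norm_le_norm_of_ae_le ?_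
    filter_upwards [coeFn_mulOp_indicator hE hμE (f i)] with x hx
    rw [hx]
    exact norm_indicator_le_norm_self _ _
  · exact (coeFn_mulOp_indicator hE hμE (f i)).trans (hmem i).coeFn_toLp.symm
  · have h1 : ∑ i ∈ t, ‖mulOp μ (hmem i).toLp η‖ₑ ^ 2 ≤ ENNReal.ofReal C * ‖η‖ₑ ^ 2 := by
      simp only [Lp_two_enorm_sq]
      rw [← lintegral_finsetSum _ fun i _ => (Lp.stronglyMeasurable _).enorm.pow_const 2,
        ← lintegral_const_mul _ ((Lp.stronglyMeasurable _).enorm.pow_const 2)]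
      refine lintegral_mono_ae ?_
      have hae : ∀ᵐ x ∂μ, ∀ i, mulOp μ (hmem i).toLp η x = E.indicator (f i) x * η x := by
        rw [ae_all_iff]
        intro i
        filter_upwards [coeFn_mulOp μ (hmem i).toLp η, (hmem i).coeFn_toLp] with x h1 h2
        rw [h1, h2]
      filter_upwards [hae] with x hx
      simp only [hx, enorm_mul, mul_pow]
      rw [← Finset.sum_mul]
      gcongr
      by_cases hxE : x ∈ E
      · simp only [Set.indicator_of_mem hxE]
        exact (ENNReal.sum_le_tsum t).trans (h x hxE)
      · simp [Set.indicator_of_notMem hxE]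
    have h2 : ENNReal.ofReal (∑ i ∈ t, ‖mulOp μ (hmem i).toLp η‖ ^ 2) ≤
        ENNReal.ofReal (C * ‖η‖ ^ 2) := by
      rw [ENNReal.ofReal_mul hC, ENNReal.ofReal_sum_of_nonneg fun _ _ => by positivity]
      simpa only [ENNReal.ofReal_pow (norm_nonneg _), ofReal_norm] using h1
    exact (ENNReal.ofReal_le_ofReal_iff (by positivity)).1 h2

theorem tendsto_mulOp_indicator {E : ℕ → Set X} (hE : ∀ n, MeasurableSet (E n))
    (hμE : ∀ n, μ (E n) ≠ ∞) (hlim : ∀ᵐ x ∂μ, ∀ᶠ n in Filter.atTop, x ∈ E n) (η : Lp ℂ 2 μ) :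
    Filter.Tendsto (fun n => mulOp μ (indicatorConstLp ∞ (hE n) (hμE n) (1 : ℂ)) η)
      Filter.atTop (𝓝 η) := by
  rw [tendsto_iff_norm_sub_tendsto_zero]
  have h1 : ∀ n, ‖mulOp μ (indicatorConstLp ∞ (hE n) (hμE n) (1 : ℂ)) η - η‖ₑ ^ 2 =
      ∫⁻ x, ‖(E n)ᶜ.indicator η x‖ₑ ^ 2 ∂μ := by
    intro n
    rw [Lp_two_enorm_sq]
    refine lintegral_congr_ae ?_
    filter_upwards [coeFn_mulOp_indicator (hE n) (hμE n) η, Lp.coeFn_sub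
      (mulOp μ (indicatorConstLp ∞ (hE n) (hμE n) (1 : ℂ)) η) η] with x h1 h2
    rw [h2, Pi.sub_apply, h1]
    by_cases hx : x ∈ E n <;> simp [hx]
  have h2 : Filter.Tendsto (fun n => ∫⁻ x, ‖(E n)ᶜ.indicator η x‖ₑ ^ 2 ∂μ) Filter.atTop
      (𝓝 (∫⁻ _, 0 ∂μ)) := by
    refine tendsto_lintegral_of_dominated_convergence (fun x => ‖η x‖ₑ ^ 2) (fun n => ?_)
      (fun n => Filter.Eventually.of_forall fun x => ?_) ?_ ?_
    · exact (((Lp.stronglyMeasurable η).indicator (hE n).compl).enorm).pow_const 2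
    · by_cases hx : x ∈ E n <;> simp [hx]
    · rw [← Lp_two_enorm_sq]
      exact ENNReal.pow_ne_top enorm_ne_top
    · filter_upwards [hlim] with x hx
      refine tendsto_const_nhds.congr' ?_
      filter_upwards [hx] with n hn
      simp [hn]
  simp only [← h1, lintegral_zero] at h2
  have h3 := (ENNReal.tendsto_toReal ENNReal.zero_ne_top).comp h2
  have h4 := h3.sqrt
  simpa [Function.comp_def] using h4

/-- Cutoffs exist for any two square summable sequences. -/
theorem exists_isCutoff [SigmaFinite μ] {f g : ℕ → Lp ℂ 2 μ} (hf : SqSummable f)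
    (hg : SqSummable g) : ∃ M, IsCutoff M f g := by
  let F : X → ℝ≥0∞ := fun x => ∑' i, ‖f i x‖ₑ ^ 2 + ∑' i, ‖g i x‖ₑ ^ 2
  have hmeas : ∀ f : ℕ → Lp ℂ 2 μ, Measurable fun x => ∑' i, ‖f i x‖ₑ ^ 2 := fun f =>
    Measurable.tsum fun i => (Lp.stronglyMeasurable (f i)).enorm.pow_const 2
  have hF : Measurable F := (hmeas f).add (hmeas g)
  have hFtop : ∀ᵐ x ∂μ, F x < ∞ := by
    refine ae_lt_top hF ?_
    rw [lintegral_add_left (hmeas f)]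
    exact ENNReal.add_ne_top.2
      ⟨(lintegral_tsum_enorm_sq_lt_top hf).ne, (lintegral_tsum_enorm_sq_lt_top hg).ne⟩
  -- The sublevel set bounds both kernels' square sums at once; the spanning set gives finite
  -- measure, so the cutoff is also an `L²` vector.
  let E : ℕ → Set X := fun n => {x | F x ≤ n} ∩ spanningSets μ n
  have hE : ∀ n, MeasurableSet (E n) := fun n =>
    (measurableSet_le hF measurable_const).inter (measurableSet_spanningSets μ n)
  have hμE : ∀ n, μ (E n) ≠ ∞ := fun n =>
    ((measure_mono Set.inter_subset_right).trans_lt (measure_spanningSets_lt_top μ n)).ne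
  have hlim : ∀ᵐ x ∂μ, ∀ᶠ n in Filter.atTop, x ∈ E n := by
    filter_upwards [hFtop] with x hx
    obtain ⟨N, hN⟩ := ENNReal.exists_nat_gt hx.ne
    filter_upwards [Filter.eventually_ge_atTop N, eventually_mem_spanningSets μ x] with n hn hs
    exact ⟨hN.le.trans (by exact_mod_cast hn), hs⟩
  refine ⟨fun n => indicatorConstLp ∞ (hE n) (hμE n) (1 : ℂ), fun n =>
    ⟨indicatorConstLp 2 (hE n) (hμE n) 1, indicatorConstLp_coeFn.trans
      indicatorConstLp_coeFn.symm⟩, fun n η => Lp.norm_le_norm_of_ae_le ?_,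
    tendsto_mulOp_indicator hE hμE hlim, fun n => ?_, fun n => ?_, fun n => ?_⟩
  · filter_upwards [coeFn_mulOp_indicator (hE n) (hμE n) η] with x hx
    rw [hx]
    exact norm_indicator_le_norm_self _ _
  · rw [adjoint_mulOp]
    congr 1
    refine Lp.ext ?_
    filter_upwards [Lp.coeFn_star (indicatorConstLp ∞ (hE n) (hμE n) (1 : ℂ)),
      indicatorConstLp_coeFn (p := ∞) (hs := hE n) (hμs := hμE n) (c := (1 : ℂ))] with x h1 h2
    rw [h1, Pi.star_apply, h2]
    by_cases hx : x ∈ E n <;> simp [hx]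
  · refine exists_isBoundedRep_indicator (hE n) (hμE n) hf n.cast_nonneg fun x hx => ?_
    rw [ENNReal.ofReal_natCast]
    exact le_self_add.trans hx.1
  · refine exists_isBoundedRep_indicator (hE n) (hμE n) hg n.cast_nonneg fun x hx => ?_
    rw [ENNReal.ofReal_natCast]
    exact le_add_self.trans hx.1

end Multiplication

/-! ### Norm separation and transfer of operators across a pairing -/

section Separation

theorem exists_dual_of_notMem_closure {E : Type*} [NormedAddCommGroup E] [NormedSpace ℂ E]
    (W : Submodule ℂ E) {x : E} (hx : x ∉ closure (W : Set E)) :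
    ∃ φ : E →L[ℂ] ℂ, (∀ w ∈ W, φ w = 0) ∧ φ x ≠ 0 := by
  let N := W.topologicalClosure
  have : IsClosed (N : Set E) := W.isClosed_topologicalClosure
  have hne : N.mkQ x ≠ 0 := fun h => hx ((Submodule.Quotient.mk_eq_zero N).1 h)
  obtain ⟨ψ, hψ⟩ := SeparatingDual.exists_ne_zero (R := ℂ) hne
  refine ⟨ψ ∘L N.mkQL, fun w hw => ?_, hψ⟩
  have : N.mkQ w = 0 := (Submodule.Quotient.mk_eq_zero N).2 (W.le_topologicalClosure hw)
  change ψ (N.mkQ w) = 0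
  rw [this, map_zero]

variable {H : Type*} [NormedAddCommGroup H] [InnerProductSpace ℂ H] [CompleteSpace H]

theorem pairing_comp {ι : Type*} {f g : ι → H} (hf : SqSummable f) (hg : SqSummable g)
    {A B : H →L[ℂ] H} (hA : SqSummable fun i => A (f i)) (hB : SqSummable fun i => B (g i))
    (T : H →L[ℂ] H) : pairing (fun i => A (f i)) (fun i => B (g i)) T =
      pairing f g (ContinuousLinearMap.adjoint B ∘L T ∘L A) := by
  rw [pairing_apply hA hB, pairing_apply hf hg]
  simp [ContinuousLinearMap.adjoint_inner_right]

end Separation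

/-! ### Annihilators of masa-bimodules and products of kernels -/

section Bimodule

open ContinuousLinearMap

variable {X : Type*} [MeasurableSpace X] {μ : Measure X}
  {U V : Submodule ℂ (Lp ℂ 2 μ →L[ℂ] Lp ℂ 2 μ)}

theorem IsMasaBimodule.adjoint_comp_mem (hU : IsMasaBimodule μ U)
    {T : Lp ℂ 2 μ →L[ℂ] Lp ℂ 2 μ} (hT : T ∈ U) (a b : Lp ℂ ∞ μ) :
    adjoint (mulOp μ b) ∘L T ∘L mulOp μ a ∈ U := by
  rw [adjoint_mulOp]
  exact hU T hT _ ⟨_, rfl⟩ _ ⟨_, rfl⟩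

theorem IsMasaBimodule.inf_compacts (hU : IsMasaBimodule μ U) :
    IsMasaBimodule μ (U ⊓ compacts (Lp ℂ 2 μ)) := fun T hT A hA B hB =>
  ⟨hU T hT.1 A hA B hB, (IsCompactOperator.comp_clm hT.2 B).clm_comp A⟩

/-- A functional vanishing on a masa-bimodule still vanishes on it after a cutoff. -/
theorem IsCutoff.pairing_eq_zero {M : ℕ → Lp ℂ ∞ μ} {f g : ℕ → Lp ℂ 2 μ} (hM : IsCutoff M f g)
    (hU : IsMasaBimodule μ U) (hf : SqSummable f) (hg : SqSummable g)
    (h0 : ∀ T ∈ U, pairing f g T = 0) (n : ℕ) :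
    ∀ T ∈ U, pairing (fun i => mulOp μ (M n) (f i)) (fun i => mulOp μ (M n) (g i)) T = 0 := by
  intro T hT
  rw [pairing_comp hf hg (hf.of_norm_le fun i => hM.norm_le n _)
    (hg.of_norm_le fun i => hM.norm_le n _)]
  exact h0 _ (hU.adjoint_comp_mem hT _ _)

/-- Bounded sequences suffice to test membership in a weak* closed masa-bimodule. -/
theorem IsWeakStarClosedMasaBimodule.mem_of_forall_isBoundedRep [SigmaFinite μ]
    (hU : IsWeakStarClosedMasaBimodule μ U) {R : Lp ℂ 2 μ →L[ℂ] Lp ℂ 2 μ}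
    (h : ∀ (f g : ℕ → Lp ℂ 2 μ) (p q : ℕ → Lp ℂ ∞ μ), IsBoundedRep f p → IsBoundedRep g q →
      (∀ T ∈ U, pairing f g T = 0) → pairing f g R = 0) : R ∈ U := by
  by_contra hR
  obtain ⟨f, g, hf, hg, h0, hne⟩ := exists_pairing_of_notMem hU.isClosed hR
  obtain ⟨M, hM⟩ := exists_isCutoff hf hg
  refine hne (tendsto_nhds_unique (tendsto_pairing_comp hf hg hM.norm_le hM.tendsto R) ?_)
  refine tendsto_const_nhds.congr fun n => ?_
  obtain ⟨p, hp⟩ := hM.left n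
  obtain ⟨q, hq⟩ := hM.right n
  exact (h _ _ p q hp hq (hM.pairing_eq_zero hU.isMasaBimodule hf hg h0 n)).symm

/-- The product of two elements of the predual is commutative. -/
theorem pairing_prod_comm
    {f g f' g' : ℕ → Lp ℂ 2 μ} {p q p' q' : ℕ → Lp ℂ ∞ μ}
    (hf : IsBoundedRep f p) (hg : IsBoundedRep g q)
    (hf' : IsBoundedRep f' p') (hg' : IsBoundedRep g' q')
    (T : Lp ℂ 2 μ →L[ℂ] Lp ℂ 2 μ) :
    pairing (fun x : ℕ × ℕ => mulOp μ (p x.1) (f' x.2))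
        (fun x : ℕ × ℕ => mulOp μ (q x.1) (g' x.2)) T =
      pairing (fun x : ℕ × ℕ => mulOp μ (p' x.1) (f x.2))
        (fun x : ℕ × ℕ => mulOp μ (q' x.1) (g x.2)) T := by
  rw [pairing_apply (hf.column.sqSummable_prod hf'.sqSummable)
    (hg.column.sqSummable_prod hg'.sqSummable), pairing_apply
    (hf'.column.sqSummable_prod hf.sqSummable) (hg'.column.sqSummable_prod hg.sqSummable),
    ← (Equiv.prodComm ℕ ℕ).tsum_eq]
  refine tsum_congr fun x => ?_
  simp only [Equiv.prodComm_apply, Prod.fst_swap, Prod.snd_swap]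
  rw [mulOp_swap (hf.ae_eq x.2) (hf'.ae_eq x.1), mulOp_swap (hg.ae_eq x.2) (hg'.ae_eq x.1)]

/-- If one factor vanishes on a masa-bimodule then so does the product. -/
theorem pairing_prod_eq_zero_of_mem
    {f g f' g' : ℕ → Lp ℂ 2 μ} {p q p' q' : ℕ → Lp ℂ ∞ μ}
    (hf : IsBoundedRep f p) (hg : IsBoundedRep g q)
    (hf' : IsBoundedRep f' p') (hg' : IsBoundedRep g' q')
    (hV : IsMasaBimodule μ V)
    (h0 : ∀ T ∈ V, pairing f' g' T = 0) {T : Lp ℂ 2 μ →L[ℂ] Lp ℂ 2 μ} (hT : T ∈ V) :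
    pairing (fun x : ℕ × ℕ => mulOp μ (p x.1) (f' x.2))
        (fun x : ℕ × ℕ => mulOp μ (q x.1) (g' x.2)) T = 0 :=
  pairing_prod_eq_zero hf.column hg.column hf'.sqSummable hg'.sqSummable
    fun _ => h0 _ (hV.adjoint_comp_mem hT _ _)

theorem pairing_columnSum_comm
    {f g f' g' : ℕ → Lp ℂ 2 μ} {p q p' q' : ℕ → Lp ℂ ∞ μ}
    (hf : IsBoundedRep f p) (hg : IsBoundedRep g q)
    (hf' : IsBoundedRep f' p') (hg' : IsBoundedRep g' q')
    {K : Lp ℂ 2 μ →L[ℂ] Lp ℂ 2 μ} (hK : IsCompactOperator K) :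
    pairing f' g' (columnSum (fun i => mulOp μ (p i)) (fun i => mulOp μ (q i)) K) =
      pairing f g (columnSum (fun i => mulOp μ (p' i)) (fun i => mulOp μ (q' i)) K) := by
  rw [pairing_columnSum hf.column hg.column hf.column_adjoint hg.column_adjoint hK
    hf'.sqSummable hg'.sqSummable, pairing_columnSum hf'.column hg'.column hf'.column_adjoint
    hg'.column_adjoint hK hf.sqSummable hg.sqSummable, pairing_prod_comm hf hg hf' hg']

/-- Multiplying a compact element of the weak* closure of `U + V` by an element of the predual
vanishing on `U` gives an element of `V`. -/
theorem columnSum_mem [SigmaFinite μ] (hU : IsMasaBimodule μ U)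
    (hV : IsWeakStarClosedMasaBimodule μ V) {K : Lp ℂ 2 μ →L[ℂ] Lp ℂ 2 μ}
    (hK : IsCompactOperator K) (hKUV : K ∈ closure[weakStarTopology (Lp ℂ 2 μ)]
      ((U ⊔ V : Submodule ℂ (Lp ℂ 2 μ →L[ℂ] Lp ℂ 2 μ)) : Set (Lp ℂ 2 μ →L[ℂ] Lp ℂ 2 μ)))
    {f g : ℕ → Lp ℂ 2 μ} {p q : ℕ → Lp ℂ ∞ μ} (hf : IsBoundedRep f p) (hg : IsBoundedRep g q)
    (h0 : ∀ T ∈ U, pairing f g T = 0) :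
    columnSum (fun i => mulOp μ (p i)) (fun i => mulOp μ (q i)) K ∈ V := by
  refine hV.mem_of_forall_isBoundedRep fun f' g' p' q' hf' hg' h0' => ?_
  rw [pairing_columnSum hf.column hg.column hf.column_adjoint hg.column_adjoint hK
    hf'.sqSummable hg'.sqSummable]
  refine pairing_eq_zero_of_mem_closure (hf.column.sqSummable_prod hf'.sqSummable)
    (hg.column.sqSummable_prod hg'.sqSummable) (fun T hT => ?_) hKUV
  obtain ⟨A, hA, B, hB, rfl⟩ := Submodule.mem_sup.1 hT
  -- On `A ∈ U` the product is commuted so that the factor annihilating `U` acts last; on `B ∈ V` it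
  -- is already in the right order.
  rw [map_add, pairing_prod_comm hf hg hf' hg', pairing_prod_eq_zero_of_mem hf' hg' hf hg hU h0 hA,
    pairing_prod_eq_zero_of_mem hf hg hf' hg' hV.isMasaBimodule h0' hB, add_zero]

/-- Multiplying a compact element of the weak* closure of `U + V` by an element of the predual
vanishing on the compact operators in `V` gives an element of `U`. -/
theorem columnSum_mem_of_compacts [SigmaFinite μ] (hU : IsWeakStarClosedMasaBimodule μ U)
    (hV : IsWeakStarClosedMasaBimodule μ V) {K : Lp ℂ 2 μ →L[ℂ] Lp ℂ 2 μ}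
    (hK : IsCompactOperator K) (hKUV : K ∈ closure[weakStarTopology (Lp ℂ 2 μ)]
      ((U ⊔ V : Submodule ℂ (Lp ℂ 2 μ →L[ℂ] Lp ℂ 2 μ)) : Set (Lp ℂ 2 μ →L[ℂ] Lp ℂ 2 μ)))
    {f g : ℕ → Lp ℂ 2 μ} {p q : ℕ → Lp ℂ ∞ μ} (hf : IsBoundedRep f p) (hg : IsBoundedRep g q)
    (h0 : ∀ T ∈ V ⊓ compacts (Lp ℂ 2 μ), pairing f g T = 0) :
    columnSum (fun i => mulOp μ (p i)) (fun i => mulOp μ (q i)) K ∈ U := by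
  refine hU.mem_of_forall_isBoundedRep fun f' g' p' q' hf' hg' h0' => ?_
  rw [pairing_columnSum_comm hf hg hf' hg' hK]
  exact h0 _ ⟨columnSum_mem hU.isMasaBimodule hV hK hKUV hf' hg' h0',
    isCompactOperator_columnSum hf'.column hg'.column hf'.column_adjoint hg'.column_adjoint hK⟩

/-- If `ξ` is the `L²` class of a cutoff, pairing `K` with the cut-off kernel is the matrix
coefficient of the column sum at `(ξ, ξ)`, hence zero; the cutoffs then tend to the identity. -/
theorem pairing_eq_zero_of_columnSum_eq_zero [SigmaFinite μ] {K : Lp ℂ 2 μ →L[ℂ] Lp ℂ 2 μ}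
    (hK : IsCompactOperator K) {f g : ℕ → Lp ℂ 2 μ} {p q : ℕ → Lp ℂ ∞ μ}
    (hf : IsBoundedRep f p) (hg : IsBoundedRep g q)
    (h0 : columnSum (fun i => mulOp μ (p i)) (fun i => mulOp μ (q i)) K = 0) :
    pairing f g K = 0 := by
  obtain ⟨M, hM⟩ := exists_isCutoff hf.sqSummable hg.sqSummable
  refine tendsto_nhds_unique
    (tendsto_pairing_comp hf.sqSummable hg.sqSummable hM.norm_le hM.tendsto K) ?_
  refine tendsto_const_nhds.congr fun n => ?_
  obtain ⟨ξ, hξ⟩ := hM.exists_L2 n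
  have h1 : ∀ i, mulOp μ (M n) (f i) = mulOp μ (p i) ξ := fun i => mulOp_swap hξ (hf.ae_eq i)
  have h2 : ∀ i, mulOp μ (M n) (g i) = mulOp μ (q i) ξ := fun i => mulOp_swap hξ (hg.ae_eq i)
  have h3 := hasSum_inner_columnSum hf.column hg.column hf.column_adjoint hg.column_adjoint hK ξ ξ
  rw [h0, zero_apply, inner_zero_right] at h3
  simp only [h1, h2]
  exact h3.unique (hasSum_pairing (hf.column.sqSummable ξ) (hg.column.sqSummable ξ) K)

end Bimodule

/-! ### The two inclusions -/

theorem theorem4p2 {X : Type*} [MeasurableSpace X] [StandardBorelSpace X]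
    (μ : Measure X) [SigmaFinite μ]
    (U V : Submodule ℂ (Lp ℂ 2 μ →L[ℂ] Lp ℂ 2 μ))
    (hU : IsWeakStarClosedMasaBimodule μ U) (hV : IsWeakStarClosedMasaBimodule μ V)
    (hUV : IsBimoduleOfUniqueness μ (U ⊓ V)) :
    closure[weakStarTopology (Lp ℂ 2 μ)] ((U ⊔ V : Submodule ℂ (Lp ℂ 2 μ →L[ℂ] Lp ℂ 2 μ)) :
        Set (Lp ℂ 2 μ →L[ℂ] Lp ℂ 2 μ)) ∩ (compacts (Lp ℂ 2 μ) : Set (Lp ℂ 2 μ →L[ℂ] Lp ℂ 2 μ)) =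
      closure (((U ⊓ compacts (Lp ℂ 2 μ)) ⊔ (V ⊓ compacts (Lp ℂ 2 μ)) :
        Submodule ℂ (Lp ℂ 2 μ →L[ℂ] Lp ℂ 2 μ)) : Set (Lp ℂ 2 μ →L[ℂ] Lp ℂ 2 μ)) := by
  refine Set.Subset.antisymm ?_ (Set.subset_inter ?_ ?_)
  · rintro K ⟨hKUV, hK⟩
    by_contra hKW
    obtain ⟨φ, hφ, hφK⟩ := exists_dual_of_notMem_closure _ hKW
    obtain ⟨f, g, hf, hg, hfg⟩ := exists_pairing_eq_on_compacts φ
    rw [hfg K hK] at hφK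
    obtain ⟨M, hM⟩ := exists_isCutoff hf hg
    refine hφK (tendsto_nhds_unique
      (tendsto_pairing_comp hf hg hM.norm_le hM.tendsto K) ?_)
    refine tendsto_const_nhds.congr fun n => ?_
    obtain ⟨p, hp⟩ := hM.left n
    obtain ⟨q, hq⟩ := hM.right n
    have h0U := hM.pairing_eq_zero hU.isMasaBimodule.inf_compacts hf hg
      (fun T hT => by rw [← hfg T hT.2]; exact hφ T (Submodule.mem_sup_left hT)) n
    have h0V := hM.pairing_eq_zero hV.isMasaBimodule.inf_compacts hf hg
      (fun T hT => by rw [← hfg T hT.2]; exact hφ T (Submodule.mem_sup_right hT)) n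
    have hbot : (U ⊓ V) ⊓ compacts (Lp ℂ 2 μ) = ⊥ := by
      by_contra h
      exact hUV.2 ⟨hUV.1, h⟩
    refine (pairing_eq_zero_of_columnSum_eq_zero hK hp hq ?_).symm
    -- Uniqueness enters here: the column sum of `K` is compact and lies in both `U` and `V`.
    rw [← Submodule.mem_bot ℂ, ← hbot]
    exact ⟨⟨columnSum_mem_of_compacts hU hV hK hKUV hp hq h0V,
      columnSum_mem_of_compacts hV hU hK (by rwa [sup_comm]) hp hq h0U⟩,
      isCompactOperator_columnSum hp.column hq.column hp.column_adjoint hq.column_adjoint hK⟩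
  -- A weak* closed set is norm closed, so it suffices to contain the algebraic sum.
  · refine closure_minimal ?_
      ((@isClosed_closure _ (weakStarTopology (Lp ℂ 2 μ)) _).mono norm_le_weakStarTopology)
    exact Set.Subset.trans (SetLike.coe_subset_coe.2 (sup_le_sup inf_le_left inf_le_left))
      (@subset_closure _ (weakStarTopology (Lp ℂ 2 μ)) _)
  · refine closure_minimal ?_ isClosed_setOfPred_isCompactOperator
    exact SetLike.coe_subset_coe.2 (sup_le inf_le_right inf_le_right)
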